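/- Let $N\ge 1$ be an integer (the number of ports), $W>0$ and $\lambda>0$ real numbers and $\kappa\ge 0$ (the Rician factor), and put $A=\sqrt{\kappa/(\kappa+1)}$, $\sigma=\sqrt{1/(\kappa+1)}$. The ports $1,\dots,N$ are equally spaced on a segment of length $W\lambda$, port $n$ lying at distance $l_n=\frac{n-1}{N-1}W\lambda$ from port $1$ ($l_1=0$ if $N=1$), and for $2\le n\le N$ let $\rho_n=J_0(2\pi l_n/\lambda)$, where $J_0$ is the zero-order Bessel function of the first kind. Let $x_0,y_0,x_2,y_2,\dots,x_N,y_N$ be independent real Gaussian random variables with mean $0$ and variance $1/2$, and define the channel coefficients of the Rx-SISO-FAS model by $$h_1=\sigma x_0+j\sigma y_0+A,\qquad h_n=\sigma\bigl(\sqrt{1-\rho_n^2}\,x_n+\rho_n x_0\bigr)+j\sigma\bigl(\sqrt{1-\rho_n^2}\,y_n+\rho_n y_0\bigr)+A\quad(2\le n\le N).$$ Let $|h_{\mathrm{FAS}}|=\max_{1\le n\le N}|h_n|$, and for $\gamma_{th}>0$ let $$p_{out}(\gamma_{th})=P\left(\frac{|h_{\mathrm{FAS}}|^2}{A^2+\sigma^2}<\gamma_{th}\right)$$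 be the outage probability. Then the diversity order is the number of ports: the limit below exists and $$-\lim_{\gamma_{th}\to 0^+}\frac{\log p_{out}(\gamma_{th})}{\log(1/\gamma_{th})}=N.$$ -/

import Mathlib

open MeasureTheory ProbabilityTheory Filter Topology

noncomputable section

namespace FluidAntenna

/-- The zero-order Bessel function of the first kind, by Bessel's integral
`J₀(x) = (1/π) ∫₀^π cos (x sin θ) dθ`. -/
def besselJ0 (x : ℝ) : ℝ :=
  (1 / Real.pi) * ∫ θ in (0 : ℝ)..Real.pi, Real.cos (x * Real.sin θ)

/-- Displacement, from the reference port, of the ports of a uniform linear array of total length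
`W * wl` (`wl` is the carrier wavelength). The index `i : Fin N` is the port number minus one. For
`N = 1` the only port is the reference port and the value is `0`. -/
def displacement (N : ℕ) (W wl : ℝ) (i : Fin N) : ℝ :=
  ((i : ℕ) : ℝ) / ((N : ℝ) - 1) * (W * wl)

/-- Correlation factor between a port and the reference port. -/
def corr (N : ℕ) (W wl : ℝ) (i : Fin N) : ℝ :=
  besselJ0 (2 * Real.pi * (displacement N W wl i / wl))

/-- Amplitude `A` of the line-of-sight path, `A² = κ / (κ + 1)`. -/
def losAmp (κ : ℝ) : ℝ := Real.sqrt (κ / (κ + 1))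

/-- Amplitude `σ` of the scattered paths, `σ² = 1 / (κ + 1)`. -/
def nlosAmp (κ : ℝ) : ℝ := Real.sqrt (1 / (κ + 1))

/-- The small-scale fading coefficient at each port, for an outcome `x, y : Fin N → ℝ` of the
underlying real variables. The entries `x 0, y 0` belong to the reference port and are shared by
all ports; for `i ≠ 0` the entries `x i, y i` are the port's own. -/
def channel (N : ℕ) [NeZero N] (W wl κ : ℝ) (x y : Fin N → ℝ) (i : Fin N) : ℂ :=
  if i = 0 then
    ⟨nlosAmp κ * x 0 + losAmp κ, nlosAmp κ * y 0⟩
  else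
    ⟨nlosAmp κ * (Real.sqrt (1 - corr N W wl i ^ 2) * x i + corr N W wl i * x 0) + losAmp κ,
      nlosAmp κ * (Real.sqrt (1 - corr N W wl i ^ 2) * y i + corr N W wl i * y 0)⟩

/-- Channel gain `|h_FAS|` of the strongest port. -/
def fasGain (N : ℕ) [NeZero N] (W wl κ : ℝ) (x y : Fin N → ℝ) : ℝ :=
  Finset.univ.sup' Finset.univ_nonempty fun i : Fin N => ‖channel N W wl κ x y i‖

/-- Outage probability at the threshold `γ`: the probability that the received SNR of the strongest
port, normalized by the average SNR, is below `γ`. -/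
def outageProb {Ω : Type*} [MeasurableSpace Ω] (μ : Measure Ω) (N : ℕ) [NeZero N] (W wl κ : ℝ)
    (x y : Fin N → Ω → ℝ) (γ : ℝ) : ℝ :=
  μ.real {ω | fasGain N W wl κ (fun i => x i ω) (fun i => y i ω) ^ 2 /
    (losAmp κ ^ 2 + nlosAmp κ ^ 2) < γ}

/-- The outage probability `p`, as a function of the threshold, has diversity order `d`: the limit
of `-log p(γ) / log (1/γ)` as `γ` decreases to `0` exists and equals `d`. -/
def HasDiversityOrder (p : ℝ → ℝ) (d : ℝ) : Prop :=
  Tendsto (fun γ : ℝ => -(Real.log (p γ) / Real.log (1 / γ))) (𝓝[>] 0) (𝓝 d)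

end FluidAntenna

end

/-!
The fading coefficients form an affine image of the `2 * N` independent Gaussian variables, and this
affine map `g` is bijective because `|J₀(x)| < 1` for `x ≠ 0`, so that every port carries some
randomness of its own. The strongest gain is the sup norm of `g`, hence the outage event at the
threshold `γ` is `{z | ‖g z‖ < √γ}`: the homothetic image with ratio `√γ`, centred at the zero of
`g`, of a fixed bounded open set. Its volume is a constant times `√γ ^ (2 * N) = γ ^ N`. As the
Gaussian density is continuous and positive at the zero of `g`, the outage probability has the same
order `γ ^ N`, and taking logarithms gives the exponent `N`.
-/

namespace FluidAntenna

open Asymptotics Module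

open scoped ENNReal NNReal

section DiversityOrder

theorem isBigO_log_sub_log_of_isTheta {α : Type*} {l : Filter α} {f g : α → ℝ} (h : f =Θ[l] g) :
    (fun x => Real.log (f x) - Real.log (g x)) =O[l] fun _ => (1 : ℝ) := by
  obtain ⟨C, hC, hfg⟩ := h.1.exists_pos
  obtain ⟨D, hD, hgf⟩ := h.2.exists_pos
  refine IsBigO.of_bound (|Real.log C| + |Real.log D|) ?_
  filter_upwards [hfg.bound, hgf.bound] with x hf hg
  simp only [Real.norm_eq_abs] at hf hg
  rcases eq_or_ne (g x) 0 with hg0 | hg0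
  · have hf0 : f x = 0 := by simpa [hg0] using hf
    simp only [hf0, hg0, sub_self, norm_zero, norm_one, mul_one]
    positivity
  have hf0 : f x ≠ 0 := fun hf0 => hg0 (by simpa [hf0] using hg)
  have hlogf : Real.log (f x) ≤ Real.log C + Real.log (g x) := by
    rw [← Real.log_abs (f x), ← Real.log_abs (g x), ← Real.log_mul hC.ne' (abs_ne_zero.2 hg0)]
    exact Real.log_le_log (abs_pos.2 hf0) hf
  have hlogg : Real.log (g x) ≤ Real.log D + Real.log (f x) := by
    rw [← Real.log_abs (f x), ← Real.log_abs (g x), ← Real.log_mul hD.ne' (abs_ne_zero.2 hf0)]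
    exact Real.log_le_log (abs_pos.2 hg0) hg
  rw [norm_one, mul_one, Real.norm_eq_abs, abs_le]
  constructor <;>
    linarith [le_abs_self (Real.log C), le_abs_self (Real.log D), abs_nonneg (Real.log C),
      abs_nonneg (Real.log D)]

theorem hasDiversityOrder_of_isTheta_rpow {p : ℝ → ℝ} {d : ℝ}
    (h : p =Θ[𝓝[>] 0] fun γ => γ ^ d) : HasDiversityOrder p d := by
  have hone : (fun _ => (1 : ℝ)) =o[𝓝[>] 0] Real.log :=
    isLittleO_const_left.2 <| .inr <| tendsto_abs_atBot_atTop.comp Real.tendsto_log_nhdsGT_zero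
  have hratio := ((isBigO_log_sub_log_of_isTheta h).trans_isLittleO hone).tendsto_div_nhds_zero
  refine Tendsto.congr' ?_ (by simpa only [zero_add] using hratio.add_const d)
  filter_upwards [Ioo_mem_nhdsGT (one_pos : (0 : ℝ) < 1)] with γ ⟨hγ, hγ1⟩
  have hlog := (Real.log_neg hγ hγ1).ne
  rw [Real.log_rpow hγ, one_div, Real.log_inv]
  field_simp
  ring

end DiversityOrder

section SmallBall

theorem withDensity_measureReal_mem_Icc {E : Type*} [MeasurableSpace E] {ν : Measure E}
    {f : E → ℝ≥0∞} {s : Set E} {c C : ℝ≥0} (hs : MeasurableSet s) (hνs : ν s ≠ ∞)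
    (hc : ∀ z ∈ s, c ≤ f z) (hC : ∀ z ∈ s, f z ≤ C) :
    (ν.withDensity f).real s ∈ Set.Icc (c * ν.real s) (C * ν.real s) := by
  have hlower : c * ν s ≤ ν.withDensity f s := by
    rw [withDensity_apply _ hs, ← setLIntegral_const]
    exact setLIntegral_mono' hs hc
  have hupper : ν.withDensity f s ≤ C * ν s := by
    rw [withDensity_apply _ hs, ← setLIntegral_const]
    exact setLIntegral_mono' hs hC
  have hfin : C * ν s ≠ ∞ := ENNReal.mul_ne_top ENNReal.coe_ne_top hνs
  constructor
  · simpa [measureReal_def] using ENNReal.toReal_mono (ne_top_of_le_ne_top hfin hupper) hlower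
  · simpa [measureReal_def] using ENNReal.toReal_mono hfin hupper

theorem isTheta_withDensity_smallSets {E ι : Type*} [TopologicalSpace E] [MeasurableSpace E]
    {ν : Measure E} [IsLocallyFiniteMeasure ν] {f : E → ℝ≥0∞} {a : E} (hf : ContinuousAt f a)
    (hf_ne_zero : f a ≠ 0) (hf_ne_top : f a ≠ ∞) {l : Filter ι} {s : ι → Set E}
    (hs : Tendsto s l (𝓝 a).smallSets) (hs_meas : ∀ᶠ i in l, MeasurableSet (s i)) :
    (fun i => (ν.withDensity f).real (s i)) =Θ[l] fun i => ν.real (s i) := by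
  obtain ⟨c, hc, hcf⟩ := ENNReal.lt_iff_exists_nnreal_btwn.1 hf_ne_zero.bot_lt
  obtain ⟨C, hfC, -⟩ := ENNReal.lt_iff_exists_nnreal_btwn.1 hf_ne_top.lt_top
  obtain ⟨U, hU, hνU⟩ := ν.finiteAt_nhds a
  have hsub := tendsto_smallSets_iff.1 hs
  have hbounds : ∀ᶠ i in l,
      (ν.withDensity f).real (s i) ∈ Set.Icc (c * ν.real (s i)) (C * ν.real (s i)) := by
    filter_upwards [hs_meas, hsub _ hU, hsub _ (hf.eventually_const_lt hcf),
      hsub _ (hf.eventually_lt_const hfC)] with i hmeas hsU hclt hltC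
    exact withDensity_measureReal_mem_Icc hmeas (measure_lt_top_mono hsU hνU).ne
      (fun z hz => (hclt hz).le) fun z hz => (hltC hz).le
  have hc_pos : (0 : ℝ) < c := NNReal.coe_pos.2 (ENNReal.coe_pos.1 hc)
  refine ⟨IsBigO.of_bound C ?_, IsBigO.of_bound (c : ℝ)⁻¹ ?_⟩ <;>
    filter_upwards [hbounds] with i ⟨hlower, hupper⟩ <;>
    simp only [Real.norm_of_nonneg measureReal_nonneg]
  · exact hupper
  · exact (le_inv_mul_iff₀ hc_pos).2 hlower

section AffineMap

theorem setOf_norm_affineMap_lt_eq_image_homothety {E F : Type*} [AddCommGroup E] [Module ℝ E]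
    [NormedAddCommGroup F] [NormedSpace ℝ F] {g : E →ᵃ[ℝ] F} {a : E} (ha : g a = 0) {r : ℝ}
    (hr : 0 < r) : {z | ‖g z‖ < r} = AffineMap.homothety a r '' {z | ‖g z‖ < 1} := by
  have hg_homothety (t : ℝ) (z : E) : g (AffineMap.homothety a t z) = t • g z := by
    rw [AffineMap.homothety_eq_lineMap, AffineMap.apply_lineMap, ha, AffineMap.lineMap_apply_module,
      smul_zero, zero_add]
  ext z
  constructor
  · intro hz
    refine ⟨AffineMap.homothety a r⁻¹ z, ?_, ?_⟩
    · rw [Set.mem_ofPred_eq, hg_homothety, norm_smul, Real.norm_of_nonneg (inv_pos.2 hr).le,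
        inv_mul_lt_iff₀ hr, mul_one]
      exact hz
    · rw [← AffineMap.homothety_mul_apply, mul_inv_cancel₀ hr.ne', AffineMap.homothety_one,
        AffineMap.id_apply]
  · rintro ⟨w, hw, rfl⟩
    rw [Set.mem_ofPred_eq, hg_homothety, norm_smul, Real.norm_of_nonneg hr.le]
    exact mul_lt_of_lt_one_right hr hw

variable {E F : Type*} [NormedAddCommGroup E] [NormedSpace ℝ E] [FiniteDimensional ℝ E]
  [NormedAddCommGroup F] [NormedSpace ℝ F] {g : E →ᵃ[ℝ] F} {a : E}

theorem exists_setOf_norm_affineMap_lt_subset_ball (hg : Function.Injective g) (ha : g a = 0) :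
    ∃ K > 0, ∀ r, {z | ‖g z‖ < r} ⊆ Metric.ball a (K * r) := by
  obtain ⟨K, hK, hanti⟩ := g.linear.exists_antilipschitzWith
    (LinearMap.ker_eq_bot.2 (g.linear_injective_iff.2 hg))
  refine ⟨K, hK, fun r z hz => ?_⟩
  have hlinear : g.linear z - g.linear a = g z := by
    rw [← map_sub, ← vsub_eq_sub, g.linearMap_vsub, ha, vsub_eq_sub, sub_zero]
  have hdist : dist z a ≤ K * ‖g z‖ := by
    simpa only [dist_eq_norm (g.linear z), hlinear] using hanti.le_mul_dist z a
  exact hdist.trans_lt (mul_lt_mul_of_pos_left hz hK)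

theorem isOpen_setOf_norm_affineMap_lt (g : E →ᵃ[ℝ] F) (r : ℝ) : IsOpen {z | ‖g z‖ < r} :=
  isOpen_lt g.continuous_of_finiteDimensional.norm continuous_const

theorem tendsto_setOf_norm_affineMap_lt_smallSets (hg : Function.Injective g) (ha : g a = 0) :
    Tendsto (fun r => {z | ‖g z‖ < r}) (𝓝[>] 0) (𝓝 a).smallSets := by
  obtain ⟨K, hK, hball⟩ := exists_setOf_norm_affineMap_lt_subset_ball hg ha
  refine Metric.nhds_basis_ball.smallSets.tendsto_right_iff.2 fun ε hε => ?_
  filter_upwards [Ioo_mem_nhdsGT (div_pos hε hK)] with r hr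
  exact (hball r).trans (Metric.ball_subset_ball ((lt_div_iff₀' hK).1 hr.2).le)

variable [MeasurableSpace E] [BorelSpace E] {ν : Measure E} [ν.IsAddHaarMeasure]

theorem isTheta_addHaar_setOf_norm_affineMap_lt (hg : Function.Injective g) (ha : g a = 0) :
    (fun r => ν.real {z | ‖g z‖ < r}) =Θ[𝓝[>] 0] fun r => r ^ finrank ℝ E := by
  obtain ⟨K, -, hball⟩ := exists_setOf_norm_affineMap_lt_subset_ball hg ha
  have hpos : 0 < ν {z | ‖g z‖ < 1} :=
    (isOpen_setOf_norm_affineMap_lt g 1).measure_pos ν ⟨a, by simp [ha]⟩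
  have hfin : ν {z | ‖g z‖ < 1} < ∞ := measure_lt_top_mono (hball 1) measure_ball_lt_top
  refine EventuallyEq.trans_isTheta ?_
    ((isTheta_refl _ _).const_mul_left (ENNReal.toReal_pos hpos.ne' hfin.ne).ne')
  filter_upwards [self_mem_nhdsWithin] with r hr
  have hr : 0 < r := hr
  rw [setOf_norm_affineMap_lt_eq_image_homothety ha hr, measureReal_def,
    Measure.addHaar_image_homothety, abs_of_pos (pow_pos hr _), ENNReal.toReal_mul,
    ENNReal.toReal_ofReal (pow_pos hr _).le, mul_comm]

theorem isTheta_withDensity_setOf_norm_affineMap_lt (hg : Function.Injective g) (ha : g a = 0)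
    {f : E → ℝ≥0∞} (hf : ContinuousAt f a) (hf_ne_zero : f a ≠ 0) (hf_ne_top : f a ≠ ∞) :
    (fun r => (ν.withDensity f).real {z | ‖g z‖ < r}) =Θ[𝓝[>] 0] fun r => r ^ finrank ℝ E :=
  (isTheta_withDensity_smallSets hf hf_ne_zero hf_ne_top
    (tendsto_setOf_norm_affineMap_lt_smallSets hg ha)
    (.of_forall fun r => (isOpen_setOf_norm_affineMap_lt g r).measurableSet)).trans
      (isTheta_addHaar_setOf_norm_affineMap_lt hg ha)

end AffineMap

end SmallBall

section GaussianDensity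

theorem pi_withDensity_ofReal {ι : Type*} [Fintype ι] {E : ι → Type*}
    [∀ i, MeasurableSpace (E i)] {ν : ∀ i, Measure (E i)} [∀ i, SigmaFinite (ν i)]
    {f : ∀ i, E i → ℝ} (hf : ∀ i, Integrable (f i) (ν i)) (hf_nonneg : ∀ i z, 0 ≤ f i z) :
    Measure.pi (fun i => (ν i).withDensity fun z => ENNReal.ofReal (f i z)) =
      (Measure.pi ν).withDensity fun z => ENNReal.ofReal (∏ i, f i (z i)) := by
  refine Measure.pi_eq fun s hs => ?_
  simp only [withDensity_apply _ (hs _), withDensity_apply _ (MeasurableSet.univ_pi hs),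
    Measure.restrict_pi_pi]
  calc ∫⁻ z, ENNReal.ofReal (∏ i, f i (z i)) ∂(Measure.pi fun i => (ν i).restrict (s i))
      = ENNReal.ofReal (∫ z, ∏ i, f i (z i) ∂(Measure.pi fun i => (ν i).restrict (s i))) :=
        (ofReal_integral_eq_lintegral_ofReal
          (Integrable.fintype_prod_dep fun i => (hf i).restrict)
          (.of_forall fun z => Finset.prod_nonneg fun i _ => hf_nonneg i (z i))).symm
    _ = ENNReal.ofReal (∏ i, ∫ z in s i, f i z ∂ν i) := by rw [integral_fintype_prod_eq_prod]
    _ = ∏ i, ENNReal.ofReal (∫ z in s i, f i z ∂ν i) :=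
        ENNReal.ofReal_prod_of_nonneg fun i _ => integral_nonneg (hf_nonneg i)
    _ = ∏ i, ∫⁻ z in s i, ENNReal.ofReal (f i z) ∂ν i := by
        congr! 1 with i
        exact ofReal_integral_eq_lintegral_ofReal (hf i).restrict (.of_forall (hf_nonneg i))

theorem continuous_gaussianPDFReal (m : ℝ) (v : ℝ≥0) : Continuous (gaussianPDFReal m v) := by
  unfold gaussianPDFReal
  fun_prop

theorem continuous_ofReal_prod_gaussianPDFReal {ι : Type*} [Fintype ι] (m : ι → ℝ) (v : ι → ℝ≥0) :
    Continuous fun w : ι → ℝ => ENNReal.ofReal (∏ i, gaussianPDFReal (m i) (v i) (w i)) :=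
  ENNReal.continuous_ofReal.comp <| continuous_finsetProd _ fun i _ =>
    (continuous_gaussianPDFReal _ _).comp (continuous_apply i)

theorem ofReal_prod_gaussianPDFReal_ne_zero {ι : Type*} [Fintype ι] (m : ι → ℝ) {v : ι → ℝ≥0}
    (hv : ∀ i, v i ≠ 0) (w : ι → ℝ) :
    ENNReal.ofReal (∏ i, gaussianPDFReal (m i) (v i) (w i)) ≠ 0 :=
  (ENNReal.ofReal_pos.2 (Finset.prod_pos fun i _ => gaussianPDFReal_pos _ _ _ (hv i))).ne'

theorem hasLaw_pi_gaussianReal_withDensity {Ω ι : Type*} [MeasurableSpace Ω] {μ : Measure Ω}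
    [Fintype ι] {z : ι → Ω → ℝ} {m : ι → ℝ} {v : ι → ℝ≥0} (hv : ∀ i, v i ≠ 0)
    (hz : ∀ i, HasLaw (z i) (gaussianReal (m i) (v i)) μ) (hind : iIndepFun z μ) :
    HasLaw (fun ω i => z i ω)
      (volume.withDensity fun w => ENNReal.ofReal (∏ i, gaussianPDFReal (m i) (v i) (w i))) μ := by
  rw [volume_pi, ← pi_withDensity_ofReal (fun i => integrable_gaussianPDFReal _ _)
    fun i => gaussianPDFReal_nonneg _ _]
  simp only [gaussianReal_of_var_ne_zero _ (hv _), gaussianPDF_def] at hz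
  exact hind.hasLaw_pi hz

end GaussianDensity

section Correlation

theorem exists_mem_Icc_abs_cos_mul_sin_lt_one {x : ℝ} (hx : x ≠ 0) :
    ∃ θ ∈ Set.Icc 0 Real.pi, |Real.cos (x * Real.sin θ)| < 1 := by
  -- `sin θ = (1 + |x|)⁻¹` puts the argument of the cosine in `(-1, 1) \ {0}`.
  have hs_pos : 0 < (1 + |x|)⁻¹ := by positivity
  have hs_le : (1 + |x|)⁻¹ ≤ 1 := inv_le_one_of_one_le₀ (by linarith [abs_nonneg x])
  refine ⟨Real.arcsin (1 + |x|)⁻¹, ⟨Real.arcsin_nonneg.2 hs_pos.le, ?_⟩, ?_⟩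
  · linarith [Real.arcsin_le_pi_div_two (1 + |x|)⁻¹, Real.pi_pos]
  rw [Real.sin_arcsin (by linarith) hs_le]
  have hlt : |x * (1 + |x|)⁻¹| < 1 := by
    rw [abs_mul, abs_of_pos hs_pos, ← div_eq_mul_inv, div_lt_one (by positivity)]
    linarith
  obtain ⟨hlow, hupp⟩ := abs_lt.1 hlt
  have hsin : Real.sin (x * (1 + |x|)⁻¹) ≠ 0 :=
    (Real.sin_eq_zero_iff_of_lt_of_lt (by linarith [Real.pi_gt_three])
      (by linarith [Real.pi_gt_three])).not.2 (mul_ne_zero hx hs_pos.ne')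
  rw [← sq_lt_one_iff_abs_lt_one, Real.cos_sq']
  linarith [sq_pos_of_ne_zero hsin]

theorem abs_besselJ0_lt_one {x : ℝ} (hx : x ≠ 0) : |besselJ0 x| < 1 := by
  have hlt : |∫ θ in (0 : ℝ)..Real.pi, Real.cos (x * Real.sin θ)| < Real.pi :=
    calc |∫ θ in (0 : ℝ)..Real.pi, Real.cos (x * Real.sin θ)|
        ≤ ∫ θ in (0 : ℝ)..Real.pi, |Real.cos (x * Real.sin θ)| :=
          intervalIntegral.abs_integral_le_integral_abs Real.pi_pos.le
      _ < ∫ _ in (0 : ℝ)..Real.pi, 1 :=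
          intervalIntegral.integral_lt_integral_of_continuousOn_of_le_of_exists_lt Real.pi_pos
            (by fun_prop) (by fun_prop) (fun _ _ => Real.abs_cos_le_one _)
            (exists_mem_Icc_abs_cos_mul_sin_lt_one hx)
      _ = Real.pi := by simp
  rwa [besselJ0, abs_mul, abs_of_pos (one_div_pos.2 Real.pi_pos), one_div_mul_eq_div,
    div_lt_one Real.pi_pos]

theorem displacement_ne_zero {N : ℕ} [NeZero N] {W wl : ℝ} (hW : W ≠ 0) (hwl : wl ≠ 0) {i : Fin N}
    (hi : i ≠ 0) : displacement N W wl i ≠ 0 := by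
  have hi_pos : 0 < (i : ℕ) := Nat.pos_of_ne_zero fun h => hi (Fin.ext h)
  have hN : (1 : ℝ) < N := Nat.one_lt_cast.2 (Nat.lt_of_le_of_lt hi_pos i.2)
  exact mul_ne_zero (div_ne_zero (Nat.cast_ne_zero.2 hi_pos.ne') (sub_pos.2 hN).ne')
    (mul_ne_zero hW hwl)

theorem abs_corr_lt_one {N : ℕ} [NeZero N] {W wl : ℝ} (hW : W ≠ 0) (hwl : wl ≠ 0) {i : Fin N}
    (hi : i ≠ 0) : |corr N W wl i| < 1 :=
  abs_besselJ0_lt_one <| mul_ne_zero Real.two_pi_pos.ne' <|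
    div_ne_zero (displacement_ne_zero hW hwl hi) hwl

end Correlation

section Channel

/-- The identification of a family of real and imaginary parts with the family of complex numbers
they define, with real parts in the left summand and imaginary parts in the right one. -/
def complexOfParts (ι : Type*) : (ι ⊕ ι → ℝ) ≃ₗ[ℝ] (ι → ℂ) where
  toFun z i := ⟨z (.inl i), z (.inr i)⟩
  invFun w := Sum.elim (fun i => (w i).re) fun i => (w i).im
  left_inv z := by ext (i | i) <;> rfl
  right_inv w := rfl
  map_add' _ _ := rfl
  map_smul' t z := funext fun i => Complex.ext (by simp) (by simp)

/-- The normalized scattered component at every port, as a function of the independent complex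
port variables: `k` is the reference port and `ρ i` the correlation of port `i` with it. -/
noncomputable def scatteredMap {ι : Type*} [DecidableEq ι] (ρ : ι → ℝ) (k : ι) :
    (ι → ℂ) →ₗ[ℝ] (ι → ℂ) :=
  LinearMap.pi fun i =>
    if i = k then .proj k else √(1 - ρ i ^ 2) • .proj i + ρ i • .proj k

theorem scatteredMap_injective {ι : Type*} [DecidableEq ι] {ρ : ι → ℝ} {k : ι}
    (hρ : ∀ i ≠ k, |ρ i| < 1) : Function.Injective (scatteredMap ρ k) := by
  refine (injective_iff_map_eq_zero _).2 fun w hw => ?_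
  have hwk : w k = 0 := by simpa [scatteredMap] using congrFun hw k
  ext1 i
  rcases eq_or_ne i k with rfl | hi
  · exact hwk
  have hsqrt : √(1 - ρ i ^ 2) ≠ 0 :=
    (Real.sqrt_pos.2 (sub_pos.2 ((sq_lt_one_iff_abs_lt_one _).2 (hρ i hi)))).ne'
  simpa [scatteredMap, hi, hwk, hsqrt] using congrFun hw i

variable {N : ℕ} [NeZero N] {W wl κ : ℝ}

/-- The fading coefficients as an affine function of the `2 * N` underlying real variables, with the
variables `x` in the left summand and `y` in the right one. -/
noncomputable def channelMap (N : ℕ) [NeZero N] (W wl κ : ℝ) :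
    (Fin N ⊕ Fin N → ℝ) →ᵃ[ℝ] (Fin N → ℂ) :=
  (nlosAmp κ • (scatteredMap (corr N W wl) 0 ∘ₗ (complexOfParts (Fin N)).toLinearMap)).toAffineMap +
    AffineMap.const ℝ _ fun _ => (losAmp κ : ℂ)

theorem channelMap_sumElim (x y : Fin N → ℝ) :
    channelMap N W wl κ (Sum.elim x y) = channel N W wl κ x y := by
  ext i : 1
  by_cases hi : i = 0 <;>
    simp [channelMap, channel, scatteredMap, complexOfParts, hi, Complex.ext_iff, mul_add]

theorem nlosAmp_pos (hκ : -1 < κ) : 0 < nlosAmp κ :=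
  Real.sqrt_pos.2 (one_div_pos.2 (by linarith))

theorem channelMap_bijective (hW : W ≠ 0) (hwl : wl ≠ 0) (hκ : -1 < κ) :
    Function.Bijective (channelMap N W wl κ) := by
  have hscattered : Function.Bijective (scatteredMap (corr N W wl) (0 : Fin N)) :=
    have hinj := scatteredMap_injective fun i hi => abs_corr_lt_one hW hwl hi
    ⟨hinj, LinearMap.injective_iff_surjective.1 hinj⟩
  have hlinear : (channelMap N W wl κ).linear =
      nlosAmp κ • (scatteredMap (corr N W wl) 0 ∘ₗ (complexOfParts (Fin N)).toLinearMap) := by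
    simp [channelMap]
  rw [← AffineMap.linear_bijective_iff, hlinear]
  exact (LinearEquiv.smulOfNeZero ℝ (Fin N → ℂ) (nlosAmp κ) (nlosAmp_pos hκ).ne').bijective.comp
    (hscattered.comp (complexOfParts (Fin N)).bijective)

theorem exists_channel_eq_zero (hW : W ≠ 0) (hwl : wl ≠ 0) (hκ : -1 < κ) :
    ∃ a b, channel N W wl κ a b = 0 := by
  obtain ⟨z, hz⟩ := (channelMap_bijective (N := N) hW hwl hκ).surjective 0
  exact ⟨z ∘ .inl, z ∘ .inr, by rw [← channelMap_sumElim, Sum.elim_comp_inl_inr, hz]⟩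

theorem fasGain_eq_norm_channel (x y : Fin N → ℝ) :
    fasGain N W wl κ x y = ‖channel N W wl κ x y‖ :=
  le_antisymm (Finset.sup'_le _ _ fun i _ => norm_le_pi_norm _ i)
    ((pi_norm_le_iff_of_nonempty _).2 fun i => Finset.le_sup' (fun j => ‖channel N W wl κ x y j‖)
      (Finset.mem_univ i))

theorem losAmp_sq_add_nlosAmp_sq (hκ : 0 ≤ κ) : losAmp κ ^ 2 + nlosAmp κ ^ 2 = 1 := by
  rw [losAmp, nlosAmp, Real.sq_sqrt (by positivity), Real.sq_sqrt (by positivity)]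
  field_simp

theorem outageProb_eq_measureReal {Ω : Type*} [MeasurableSpace Ω] (μ : Measure Ω) (hκ : 0 ≤ κ)
    (x y : Fin N → Ω → ℝ) (γ : ℝ) :
    outageProb μ N W wl κ x y γ =
      μ.real {ω | ‖channelMap N W wl κ fun j => Sum.elim x y j ω‖ < √γ} := by
  have hsplit (ω : Ω) : (fun j => Sum.elim x y j ω) = Sum.elim (x · ω) (y · ω) := by
    ext (i | i) <;> rfl
  simp only [outageProb, losAmp_sq_add_nlosAmp_sq hκ, div_one, fasGain_eq_norm_channel, hsplit,
    channelMap_sumElim, Real.lt_sqrt (norm_nonneg _)]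

theorem isTheta_outageProb {Ω : Type*} [MeasurableSpace Ω] {μ : Measure Ω} (hW : W ≠ 0)
    (hwl : wl ≠ 0) (hκ : 0 ≤ κ) {x y : Fin N → Ω → ℝ} {f : (Fin N ⊕ Fin N → ℝ) → ℝ≥0∞}
    (hlaw : HasLaw (fun ω j => Sum.elim x y j ω) (volume.withDensity f) μ)
    {a b : Fin N → ℝ} (hab : channel N W wl κ a b = 0) (hf : ContinuousAt f (Sum.elim a b))
    (hf_ne_zero : f (Sum.elim a b) ≠ 0) (hf_ne_top : f (Sum.elim a b) ≠ ∞) :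
    outageProb μ N W wl κ x y =Θ[𝓝[>] 0] fun γ => γ ^ N := by
  have hsqrt : Tendsto Real.sqrt (𝓝[>] 0) (𝓝[>] 0) :=
    tendsto_nhdsWithin_iff.2 ⟨tendsto_nhdsWithin_of_tendsto_nhds
      (by simpa using Real.continuous_sqrt.tendsto 0),
      eventually_mem_nhdsWithin.mono fun γ hγ => Real.sqrt_pos.2 hγ⟩
  obtain ⟨hupper, hlower⟩ := isTheta_withDensity_setOf_norm_affineMap_lt (ν := volume)
    (channelMap_bijective hW hwl (by linarith)).injective ((channelMap_sumElim a b).trans hab) hf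
    hf_ne_zero hf_ne_top
  have hprob (γ : ℝ) : outageProb μ N W wl κ x y γ =
      (volume.withDensity f).real {z | ‖channelMap N W wl κ z‖ < √γ} :=
    (outageProb_eq_measureReal μ hκ x y γ).trans
      (hlaw.measureReal_eq (isOpen_setOf_norm_affineMap_lt _ _).measurableSet)
  have hpow : (fun γ => √γ ^ finrank ℝ (Fin N ⊕ Fin N → ℝ)) =ᶠ[𝓝[>] 0] fun γ => γ ^ N := by
    filter_upwards [self_mem_nhdsWithin] with γ hγ
    rw [finrank_fintype_fun_eq_card, Fintype.card_sum, Fintype.card_fin, ← two_mul, pow_mul,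
      Real.sq_sqrt (le_of_lt hγ)]
  rw [funext hprob]
  exact IsTheta.trans_eventuallyEq ⟨hupper.comp_tendsto hsqrt, hlower.comp_tendsto hsqrt⟩ hpow

end Channel

end FluidAntenna

open FluidAntenna

theorem mainTheorem6_general {Ω : Type*} [MeasurableSpace Ω] {μ : Measure Ω} {N : ℕ} [NeZero N]
    {W wl κ : ℝ} (hW : W ≠ 0) (hwl : wl ≠ 0) (hκ : 0 ≤ κ) {x y : Fin N → Ω → ℝ}
    {f : (Fin N ⊕ Fin N → ℝ) → ENNReal}
    (hlaw : HasLaw (fun ω j => Sum.elim x y j ω) (volume.withDensity f) μ)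
    {a b : Fin N → ℝ} (hab : channel N W wl κ a b = 0) (hf : ContinuousAt f (Sum.elim a b))
    (hf_ne_zero : f (Sum.elim a b) ≠ 0) (hf_ne_top : f (Sum.elim a b) ≠ ⊤) :
    HasDiversityOrder (outageProb μ N W wl κ x y) N := by
  apply hasDiversityOrder_of_isTheta_rpow
  simpa only [Real.rpow_natCast] using
    isTheta_outageProb hW hwl hκ hlaw hab hf hf_ne_zero hf_ne_top

theorem mainTheorem6 {Ω : Type*} [MeasurableSpace Ω] (μ : Measure Ω) [IsProbabilityMeasure μ]
    (N : ℕ) [NeZero N] (W wl κ : ℝ) (hW : 0 < W) (hwl : 0 < wl) (hκ : 0 ≤ κ)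
    (x y : Fin N → Ω → ℝ)
    (hx : ∀ i, HasLaw (x i) (gaussianReal 0 (1 / 2)) μ)
    (hy : ∀ i, HasLaw (y i) (gaussianReal 0 (1 / 2)) μ)
    (hind : iIndepFun (Sum.elim x y) μ) :
    FluidAntenna.HasDiversityOrder (FluidAntenna.outageProb μ N W wl κ x y) (N : ℝ) := by
  obtain ⟨a, b, hab⟩ := exists_channel_eq_zero (N := N) hW.ne' hwl.ne' (by linarith : -1 < κ)
  have hlaw := hasLaw_pi_gaussianReal_withDensity (m := fun _ => 0) (v := fun _ => 1 / 2) (by simp)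
    (z := Sum.elim x y) (by rintro (i | i); exacts [hx i, hy i]) hind
  exact mainTheorem6_general hW.ne' hwl.ne' hκ hlaw hab
    (continuous_ofReal_prod_gaussianPDFReal _ _).continuousAt
    (ofReal_prod_gaussianPDFReal_ne_zero _ (by simp) _) ENNReal.ofReal_ne_top
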